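/- A \emph{graph} $\Gamma$ on a (possibly infinite) vertex set $V$ is a reflexive symmetric relation on $V$; a graph homomorphism is a relation-preserving map of vertex sets. The right-angled Artin group (RAAG) of $\Gamma$ is $A\Gamma=\langle v\in V \mid [v_1,v_2]=1 \text{ whenever } (v_1,v_2)\in\Gamma\rangle$, and a graph homomorphism $\varphi:\Gamma\to\Delta$ induces $A\varphi:A\Gamma\to A\Delta$, $v\mapsto\varphi(v)$. For a group $G$, the commutation graph $CG$ has the elements of $G$ as vertices, with $g,h$ related if and only if $gh=hg$; thus $ACG$ is generated by symbols $[g]$ ($g\in G$) subject to the relations $[g][h]=[h][g]$ whenever $gh=hg$. For a homomorphism $f:G\to H$ let $ACf:ACG\to ACH$, $[g]\mapsto[f(g)]$; let $\epsilon_G:ACG\to G$, $[g]\mapsto g$, and $\delta_G:ACG\to AC(ACG)$, $[g]\mapsto[[g]]$. An \emph{$AC$-coalgebra structure} on $G$ is a homomorphism $\mathfrak g:G\to ACG$ with $\epsilon_G\circ\mathfrak g=1_G$ and $AC\mathfrak g\circ\mathfrak g=\delta_G\circ\mathfrak g$. For a graph $\Gamma$, let $\mathfrak c_\Gamma:A\Gamma\to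 AC(A\Gamma)$ be the homomorphism sending each vertex $v$ to $[v]$. (1) A group $G$ is isomorphic to a RAAG if and only if it admits an $AC$-coalgebra structure. For every graph $\Gamma$, $\mathfrak c_\Gamma$ is an $AC$-coalgebra structure on $A\Gamma$. (2) For graphs $\Gamma,\Delta$, a group homomorphism $f:A\Gamma\to A\Delta$ equals $A\varphi$ for some graph homomorphism $\varphi:\Gamma\to\Delta$ if and only if $ACf\circ\mathfrak c_\Gamma=\mathfrak c_\Delta\circ f$. (3) More generally, for every group $G$ with an $AC$-coalgebra structure $\mathfrak g$ there are a graph $\Gamma$ and an isomorphism $e:G\to A\Gamma$ with $ACe\circ\mathfrak g=\mathfrak c_\Gamma\circ e$. If $e:G\to A\Gamma$ and $e':H\to A\Delta$ are any such isomorphisms for groups with $AC$-coalgebra structures $(G,\mathfrak g)$ and $(H,\mathfrak h)$, then a group homomorphism $f:G\to H$ satisfies $e'\circ f=A\varphi\circ e$ for some graph homomorphism $\varphi:\Gamma\to\Delta$ if and only if $ACf\circ\mathfrak g=\mathfrak h\circ f$. -/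

import Mathlib

universe u v w x

open scoped commutatorElement

/-- A graph on the vertex set `V`: a symmetric, reflexive relation on `V`. -/
structure ReflGraph (V : Type u) where
  Adj : V → V → Prop
  refl : ∀ a, Adj a a
  symm : ∀ a b, Adj a b → Adj b a

/-- A graph homomorphism: a function on vertices preserving the relation. -/
@[ext]
structure ReflGraph.Hom {V : Type u} {W : Type v} (Γ : ReflGraph V) (Δ : ReflGraph W) where
  toFun : V → W
  map_adj : ∀ a b, Γ.Adj a b → Δ.Adj (toFun a) (toFun b)

/-- The defining relators of the right-angled Artin group of `Γ`:
the commutators of adjacent vertices. -/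
def RAAG.rels {V : Type u} (Γ : ReflGraph V) : Set (FreeGroup V) :=
  {r | ∃ a b, Γ.Adj a b ∧ r = ⁅FreeGroup.of a, FreeGroup.of b⁆}

/-- The right-angled Artin group `AΓ = ⟨v ∈ V ∣ [a, b] = 1 whenever (a, b) ∈ Γ⟩`. -/
abbrev RAAG {V : Type u} (Γ : ReflGraph V) : Type u :=
  PresentedGroup (RAAG.rels Γ)

namespace RAAG

/-- The generator of `AΓ` given by a vertex. -/
def of {V : Type u} (Γ : ReflGraph V) (a : V) : RAAG Γ :=
  PresentedGroup.of a

theorem commute_of {V : Type u} (Γ : ReflGraph V) {a b : V} (h : Γ.Adj a b) :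
    Commute (of Γ a) (of Γ b) := by
  rw [← commutatorElement_eq_one_iff_commute]
  exact PresentedGroup.one_of_mem (rels := rels Γ) ⟨a, b, h, rfl⟩

/-- The homomorphism out of `AΓ` with prescribed values on the vertices. -/
def lift {V : Type u} (Γ : ReflGraph V) {G : Type v} [Group G] (t : V → G)
    (ht : ∀ a b, Γ.Adj a b → Commute (t a) (t b)) : RAAG Γ →* G :=
  PresentedGroup.toGroup (rels := rels Γ) (f := t) (by
    rintro r ⟨a, b, hab, rfl⟩
    rw [map_commutatorElement, FreeGroup.lift_apply_of, FreeGroup.lift_apply_of]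
    exact commutatorElement_eq_one_iff_commute.mpr (ht a b hab))

theorem lift_of {V : Type u} (Γ : ReflGraph V) {G : Type v} [Group G] (t : V → G)
    (ht : ∀ a b, Γ.Adj a b → Commute (t a) (t b)) (a : V) :
    lift Γ t ht (of Γ a) = t a :=
  PresentedGroup.toGroup.of _

/-- The functor `A` on morphisms: `Aφ : AΓ → AΔ` sends the generator `a` to `φ a`. -/
def map {V : Type u} {W : Type v} {Γ : ReflGraph V} {Δ : ReflGraph W} (φ : Γ.Hom Δ) :
    RAAG Γ →* RAAG Δ :=
  lift Γ (fun a => of Δ (φ.toFun a)) (fun a b h => commute_of Δ (φ.map_adj a b h))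

end RAAG

/-- The commutation graph `CG`: vertices are the elements of `G`, and two of them are
related if and only if they commute. -/
def commGraph (G : Type u) [Group G] : ReflGraph G where
  Adj g h := Commute g h
  refl g := Commute.refl g
  symm _ _ h := h.symm

/-- The functor `C` on morphisms. -/
def commGraph.map {G : Type u} {H : Type v} [Group G] [Group H] (f : G →* H) :
    (commGraph G).Hom (commGraph H) where
  toFun := f
  map_adj _ _ h := Commute.map h f

/-- The group `ACG`. -/
abbrev AC (G : Type u) [Group G] : Type u := RAAG (commGraph G)

/-- The homomorphism `ACf : ACG → ACH`, `[g] ↦ [f g]`. -/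
def AC.map {G : Type u} {H : Type v} [Group G] [Group H] (f : G →* H) : AC G →* AC H :=
  RAAG.map (commGraph.map f)

/-- The counit `ε : ACG → G`, `[g] ↦ g`. -/
def AC.counit (G : Type u) [Group G] : AC G →* G :=
  RAAG.lift (commGraph G) (fun g => g) (fun _ _ h => h)

/-- The unit `η : Γ → CAΓ`, sending a vertex to the corresponding generator. -/
def RAAG.unit {V : Type u} (Γ : ReflGraph V) : Γ.Hom (commGraph (RAAG Γ)) where
  toFun := RAAG.of Γ
  map_adj _ _ h := RAAG.commute_of Γ h

/-- The canonical structure map `Aη : AΓ → AC(AΓ)`, sending each generator `a` to `[a]`. -/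
def RAAG.canonical {V : Type u} (Γ : ReflGraph V) : RAAG Γ →* AC (RAAG Γ) :=
  RAAG.map (RAAG.unit Γ)

/-- The comultiplication `δ : ACG → AC(ACG)`, `[g] ↦ [[g]]`. -/
def AC.comul (G : Type u) [Group G] : AC G →* AC (AC G) :=
  RAAG.map (RAAG.unit (commGraph G))

/-- `𝔤 : G → ACG` is an `AC`-coalgebra structure on `G`: `ε ∘ 𝔤 = 1` and
`AC𝔤 ∘ 𝔤 = δ ∘ 𝔤`. -/
structure IsACCoalgebra {G : Type u} [Group G] (𝔤 : G →* AC G) : Prop where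
  counit_comp : (AC.counit G).comp 𝔤 = MonoidHom.id G
  coassoc : (AC.map 𝔤).comp 𝔤 = (AC.comul G).comp 𝔤

/-- `f : G → H` respects the structure maps: `ACf ∘ 𝔤 = 𝔥 ∘ f`. -/
def IsACCohom {G : Type u} {H : Type v} [Group G] [Group H]
    (𝔤 : G →* AC G) (𝔥 : H →* AC H) (f : G →* H) : Prop :=
  (AC.map f).comp 𝔤 = 𝔥.comp f

/-- `G` is isomorphic to a right-angled Artin group. -/
def IsRAAG (G : Type u) [Group G] : Prop :=
  ∃ (V : Type u) (Γ : ReflGraph V), Nonempty (G ≃* RAAG Γ)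

namespace RAAG

variable {V : Type u} {W : Type v} {Γ : ReflGraph V} {Δ : ReflGraph W}

/-! A full embedding of graphs induces a split injection of RAAGs: `retract` kills the vertices
outside the image. Given a coalgebra `(G, 𝔤)`, coassociativity puts `𝔤 g` where `AC𝔤` and `δ` agree.
Both are `A` of graph maps `CG → C(ACG)` with common left inverse `Cε`, and `A` preserves the
equalizer of such a pair (`exists_map_eq_of_map_eq`). So `𝔤 g` comes from the RAAG of the fixed
graph `{g | 𝔤 g = [g]}`, and injectivity of `𝔤` identifies `G` with that RAAG.

For morphisms, only vertices `x` of `AΓ` satisfy `𝔠 x = [x]`, so coalgebra homomorphisms send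
vertices to vertices; they preserve adjacency because commuting vertices are adjacent. -/

theorem hom_ext {G : Type w} [Group G] {f g : RAAG Γ →* G}
    (h : ∀ a, f (of Γ a) = g (of Γ a)) : f = g :=
  PresentedGroup.ext h

@[simp]
theorem map_of (φ : Γ.Hom Δ) (a : V) : map φ (of Γ a) = of Δ (φ.toFun a) :=
  lift_of Γ _ _ a

@[simp]
theorem canonical_of (a : V) :
    canonical Γ (of Γ a) = of (commGraph (RAAG Γ)) (of Γ a) :=
  map_of _ a

open Classical in
/-- The homomorphism `AΔ → AΓ` inverting a full embedding of graphs `φ : Γ → Δ` on its image and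
killing the vertices outside the image. -/
noncomputable def retract (φ : V → W) (hφ : ∀ a b, Δ.Adj (φ a) (φ b) → Γ.Adj a b) :
    RAAG Δ →* RAAG Γ :=
  lift Δ (fun b => if h : ∃ a, φ a = b then of Γ h.choose else 1) (by
    intro b c hbc
    by_cases hb : ∃ a, φ a = b
    · by_cases hc : ∃ a, φ a = c
      · simp only [hb, hc, dif_pos]
        refine commute_of Γ (hφ _ _ ?_)
        rwa [hb.choose_spec, hc.choose_spec]
      · simp only [hc, dif_neg, not_false_eq_true]
        exact Commute.one_right _
    · simp only [hb, dif_neg, not_false_eq_true]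
      exact Commute.one_left _)

theorem retract_of_apply (φ : V → W) (hφ : ∀ a b, Δ.Adj (φ a) (φ b) → Γ.Adj a b)
    (hinj : Function.Injective φ) (a : V) : retract φ hφ (of Δ (φ a)) = of Γ a := by
  have h : ∃ a', φ a' = φ a := ⟨a, rfl⟩
  rw [retract, lift_of, dif_pos h, hinj h.choose_spec]

theorem retract_of_notMem (φ : V → W) (hφ : ∀ a b, Δ.Adj (φ a) (φ b) → Γ.Adj a b)
    {b : W} (hb : ¬ ∃ a, φ a = b) : retract φ hφ (of Δ b) = 1 := by
  rw [retract, lift_of, dif_neg hb]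

theorem retract_map (φ : Γ.Hom Δ) (hφ : ∀ a b, Δ.Adj (φ.toFun a) (φ.toFun b) → Γ.Adj a b)
    (hinj : Function.Injective φ.toFun) (x : RAAG Γ) : retract φ.toFun hφ (map φ x) = x := by
  have : (retract φ.toFun hφ).comp (map φ) = MonoidHom.id _ :=
    hom_ext fun a => by simp [retract_of_apply φ.toFun hφ hinj]
  exact DFunLike.congr_fun this x

theorem of_ne_one (a : V) : of Γ a ≠ 1 := by
  intro h
  have := congrArg (lift Γ (fun _ => Multiplicative.ofAdd (1 : ℤ))
    (fun _ _ _ => Commute.all _ _)) h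
  rw [lift_of, (lift Γ _ _).map_one] at this
  exact absurd this (by decide)

theorem of_injective : Function.Injective (of Γ) := by
  classical
  intro a b h
  by_contra hab
  have := congrArg (lift Γ (fun c => if c = a then Multiplicative.ofAdd (1 : ℤ) else 1)
    (fun _ _ _ => Commute.all _ _)) h
  rw [lift_of, lift_of, if_pos rfl, if_neg (Ne.symm hab)] at this
  exact absurd this (by decide)

/-- Vertices commute in the right-angled Artin group only if they are adjacent. -/
theorem adj_of_commute {a b : V} (h : Commute (of Γ a) (of Γ b)) : Γ.Adj a b := by
  classical
  by_contra hab
  have hne : b ≠ a := fun e => hab (e ▸ Γ.refl b)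
  -- Two non-commuting transpositions separate `a` from `b`; sending all other vertices to `1`
  -- respects every edge, since `a` and `b` are not adjacent.
  let s : Equiv.Perm (Fin 3) := Equiv.swap 0 1
  let t : Equiv.Perm (Fin 3) := Equiv.swap 1 2
  let q : V → Equiv.Perm (Fin 3) := fun c => if c = a then s else if c = b then t else 1
  have hq : ∀ c d, Γ.Adj c d → Commute (q c) (q d) := by
    intro c d hcd
    by_cases hca : c = a
    · by_cases hda : d = a
      · rw [hca, hda]
      · by_cases hdb : d = b
        · exact absurd (hca ▸ hdb ▸ hcd) hab
        · simp [q, hda, hdb]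
    · by_cases hcb : c = b
      · by_cases hda : d = a
        · exact absurd (Γ.symm _ _ (hcb ▸ hda ▸ hcd)) hab
        · by_cases hdb : d = b
          · rw [hcb, hdb]
          · simp [q, hda, hdb]
      · simp [q, hca, hcb]
  have hst := h.map (lift Γ q hq)
  rw [lift_of, lift_of] at hst
  have : Commute s t := by simpa [q, hne] using hst
  exact absurd this (by unfold Commute SemiconjBy; decide)

/-- `A` preserves equalizers of coreflexive pairs: an element of `AΓ` on which `Aα` and `Aβ` agree
comes from the full subgraph of `Γ` on which `α` and `β` agree. -/
theorem exists_map_eq_of_map_eq {E : Type w} {Θ : ReflGraph E} (i : Θ.Hom Γ)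
    (hi : ∀ a b, Γ.Adj (i.toFun a) (i.toFun b) → Θ.Adj a b) (hinj : Function.Injective i.toFun)
    (α β : Γ.Hom Δ) (ρ : Δ.Hom Γ) (hα : ∀ a, ρ.toFun (α.toFun a) = a)
    (hβ : ∀ a, ρ.toFun (β.toFun a) = a)
    (hE : ∀ a, α.toFun a = β.toFun a → ∃ c, i.toFun c = a)
    (hE' : ∀ c, α.toFun (i.toFun c) = β.toFun (i.toFun c))
    {x : RAAG Γ} (hx : map α x = map β x) : ∃ y, map i y = x := by
  have hβ' : ∀ a b, Δ.Adj (β.toFun a) (β.toFun b) → Γ.Adj a b := fun a b h => by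
    simpa only [hβ] using ρ.map_adj _ _ h
  have hβinj : Function.Injective β.toFun := Function.LeftInverse.injective hβ
  -- On the equalizer, `α a = β a` retracts to `a`. Elsewhere `α a` is not in the image of `β`, as
  -- applying `ρ` to `β b = α a` would give `b = a`; so both sides kill `a`.
  have key : (retract β.toFun hβ').comp (map α) = (map i).comp (retract i.toFun hi) := by
    refine hom_ext fun a => ?_
    simp only [MonoidHom.comp_apply, map_of]
    by_cases ha : ∃ c, i.toFun c = a
    · obtain ⟨c, rfl⟩ := ha
      rw [hE', retract_of_apply _ _ hβinj, retract_of_apply _ _ hinj, map_of]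
    · rw [retract_of_notMem _ _ ha, map_one, retract_of_notMem]
      rintro ⟨b, hb⟩
      have hba : b = a := by rw [← hβ b, hb, hα]
      exact ha (hE a (by rw [← hb, hba]))
  refine ⟨retract i.toFun hi x, ?_⟩
  rw [← MonoidHom.comp_apply, ← key, MonoidHom.comp_apply, hx, retract_map β hβ' hβinj]

/-- The only elements of `AΓ` sent to a vertex of `AC(AΓ)` in the canonical way are vertices. -/
theorem exists_of_eq_of_canonical_eq {x : RAAG Γ}
    (hx : canonical Γ x = of (commGraph (RAAG Γ)) x) : ∃ a, of Γ a = x := by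
  by_contra h
  have hη : ∀ a b, (commGraph (RAAG Γ)).Adj ((unit Γ).toFun a) ((unit Γ).toFun b) → Γ.Adj a b :=
    fun _ _ => adj_of_commute
  have h1 := retract_map (unit Γ) hη of_injective x
  -- If `x` is not a vertex, the retraction along the unit kills `[x]`, forcing `x = 1`; but the
  -- generator `[1]` is not trivial.
  rw [show map (unit Γ) x = of (commGraph (RAAG Γ)) x from hx, retract_of_notMem (unit Γ).toFun hη h] at h1
  rw [← h1, map_one] at hx
  exact of_ne_one _ hx.symm

end RAAG

/-! ### Functoriality of `AC` and naturality of its counit and comultiplication -/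

namespace AC

variable {G : Type u} {H : Type v} {K : Type w} [Group G] [Group H] [Group K]

@[simp]
theorem map_of (f : G →* H) (g : G) :
    map f (RAAG.of (commGraph G) g) = RAAG.of (commGraph H) (f g) :=
  RAAG.map_of _ g

@[simp]
theorem counit_of (g : G) : counit G (RAAG.of (commGraph G) g) = g :=
  RAAG.lift_of _ _ _ g

@[simp]
theorem comul_of (g : G) : comul G (RAAG.of (commGraph G) g) =
    RAAG.of (commGraph (AC G)) (RAAG.of (commGraph G) g) :=
  RAAG.map_of _ g

theorem map_id : map (MonoidHom.id G) = MonoidHom.id (AC G) :=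
  RAAG.hom_ext fun g => by simp

theorem map_comp (f : H →* K) (g : G →* H) : map (f.comp g) = (map f).comp (map g) :=
  RAAG.hom_ext fun a => by simp

theorem counit_naturality (f : G →* H) : (counit H).comp (map f) = f.comp (counit G) :=
  RAAG.hom_ext fun a => by simp

theorem comul_naturality (f : G →* H) :
    (comul H).comp (map f) = (map (map f)).comp (comul G) :=
  RAAG.hom_ext fun a => by simp

end AC

namespace IsACCohom

variable {G : Type u} {H : Type v} {K : Type w} [Group G] [Group H] [Group K]
  {𝔤 : G →* AC G} {𝔥 : H →* AC H} {𝔨 : K →* AC K}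

theorem comp {f : H →* K} {g : G →* H} (hf : IsACCohom 𝔥 𝔨 f) (hg : IsACCohom 𝔤 𝔥 g) :
    IsACCohom 𝔤 𝔨 (f.comp g) := by
  unfold IsACCohom at *
  rw [AC.map_comp, MonoidHom.comp_assoc, hg, ← MonoidHom.comp_assoc, hf, MonoidHom.comp_assoc]

theorem symm {e : G ≃* H} (he : IsACCohom 𝔤 𝔥 e.toMonoidHom) :
    IsACCohom 𝔥 𝔤 e.symm.toMonoidHom := by
  have h1 : e.symm.toMonoidHom.comp e.toMonoidHom = MonoidHom.id G := by ext; simp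
  have h2 : e.toMonoidHom.comp e.symm.toMonoidHom = MonoidHom.id H := by ext; simp
  unfold IsACCohom at *
  calc (AC.map e.symm.toMonoidHom).comp 𝔥
      = (AC.map e.symm.toMonoidHom).comp ((𝔥.comp e.toMonoidHom).comp e.symm.toMonoidHom) := by
        rw [MonoidHom.comp_assoc, h2, MonoidHom.comp_id]
    _ = (AC.map (e.symm.toMonoidHom.comp e.toMonoidHom)).comp
          (𝔤.comp e.symm.toMonoidHom) := by
        rw [← he, AC.map_comp]; simp only [MonoidHom.comp_assoc]
    _ = 𝔤.comp e.symm.toMonoidHom := by rw [h1, AC.map_id, MonoidHom.id_comp]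

end IsACCohom

/-! ### Coalgebras and right-angled Artin groups -/

theorem IsACCoalgebra.of_canonical {V : Type u} (Γ : ReflGraph V) :
    IsACCoalgebra (RAAG.canonical Γ) where
  counit_comp := RAAG.hom_ext fun a => by simp
  coassoc := RAAG.hom_ext fun a => by simp

/-- Transport of a coalgebra structure along an isomorphism. -/
theorem IsACCoalgebra.transport {G : Type u} {H : Type v} [Group G] [Group H] {𝔥 : H →* AC H}
    (h𝔥 : IsACCoalgebra 𝔥) (e : G ≃* H) :
    IsACCoalgebra ((AC.map e.symm.toMonoidHom).comp (𝔥.comp e.toMonoidHom)) := by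
  have h2 : e.toMonoidHom.comp e.symm.toMonoidHom = MonoidHom.id H := by ext; simp
  constructor
  · rw [← MonoidHom.comp_assoc, AC.counit_naturality, MonoidHom.comp_assoc,
      ← MonoidHom.comp_assoc _ 𝔥, h𝔥.counit_comp]
    ext; simp
  · have h3 : (AC.map e.toMonoidHom).comp ((AC.map e.symm.toMonoidHom).comp
        (𝔥.comp e.toMonoidHom)) = 𝔥.comp e.toMonoidHom := by
      rw [← MonoidHom.comp_assoc, ← AC.map_comp, h2, AC.map_id, MonoidHom.id_comp]
    calc _ = (AC.map (AC.map e.symm.toMonoidHom)).comp ((AC.map 𝔥).comp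
          ((AC.map e.toMonoidHom).comp ((AC.map e.symm.toMonoidHom).comp
            (𝔥.comp e.toMonoidHom)))) := by
          simp only [AC.map_comp, MonoidHom.comp_assoc]
      _ = (AC.map (AC.map e.symm.toMonoidHom)).comp
            (((AC.map 𝔥).comp 𝔥).comp e.toMonoidHom) := by
          rw [h3, MonoidHom.comp_assoc]
      _ = _ := by
          rw [h𝔥.coassoc, ← MonoidHom.comp_assoc (𝔥.comp e.toMonoidHom),
            AC.comul_naturality]
          simp only [MonoidHom.comp_assoc]

/-- The homomorphisms induced by graph homomorphisms are the coalgebra homomorphisms. -/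
theorem RAAG.exists_eq_map_iff {V : Type u} {W : Type v} {Γ : ReflGraph V} {Δ : ReflGraph W}
    (f : RAAG Γ →* RAAG Δ) :
    (∃ φ : Γ.Hom Δ, f = RAAG.map φ) ↔
      IsACCohom (RAAG.canonical Γ) (RAAG.canonical Δ) f := by
  constructor
  · rintro ⟨φ, rfl⟩
    exact RAAG.hom_ext fun a => by simp
  · intro hf
    have hv : ∀ a, ∃ b, RAAG.of Δ b = f (RAAG.of Γ a) := fun a => by
      refine RAAG.exists_of_eq_of_canonical_eq ?_
      have := DFunLike.congr_fun hf (RAAG.of Γ a)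
      simpa using this.symm
    choose φ hφ using hv
    refine ⟨⟨φ, fun a b hab => RAAG.adj_of_commute ?_⟩, RAAG.hom_ext fun a => ?_⟩
    · rw [hφ, hφ]
      exact (RAAG.commute_of Γ hab).map f
    · rw [RAAG.map_of, hφ]

/-- The full subgraph of the commutation graph on the elements `g` with `𝔤 g = [g]`. -/
def fixedGraph {G : Type u} [Group G] (𝔤 : G →* AC G) :
    ReflGraph {g : G // 𝔤 g = RAAG.of (commGraph G) g} where
  Adj a b := Commute a.1 b.1
  refl a := Commute.refl a.1
  symm _ _ h := h.symm

/-- The inclusion of the fixed graph into the commutation graph. -/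
def fixedGraph.incl {G : Type u} [Group G] (𝔤 : G →* AC G) :
    (fixedGraph 𝔤).Hom (commGraph G) where
  toFun := Subtype.val
  map_adj _ _ h := h

/-- A coalgebra is identified with the right-angled Artin group of its fixed graph. -/
theorem IsACCoalgebra.exists_equiv {G : Type u} [Group G] {𝔤 : G →* AC G}
    (h : IsACCoalgebra 𝔤) :
    ∃ e : G ≃* RAAG (fixedGraph 𝔤),
      IsACCohom 𝔤 (RAAG.canonical (fixedGraph 𝔤)) e.toMonoidHom := by
  have hε : ∀ g, AC.counit G (𝔤 g) = g := DFunLike.congr_fun h.counit_comp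
  have h𝔤inj : Function.Injective 𝔤 := Function.LeftInverse.injective hε
  let ι : RAAG (fixedGraph 𝔤) →* G := RAAG.lift (fixedGraph 𝔤) Subtype.val fun _ _ hab => hab
  have hι : ∀ a, ι (RAAG.of _ a) = a.1 := fun a => RAAG.lift_of _ _ _ a
  have h𝔤ι : 𝔤.comp ι = RAAG.map (fixedGraph.incl 𝔤) := RAAG.hom_ext fun a => by
    rw [MonoidHom.comp_apply, hι, a.2, RAAG.map_of]
    rfl
  have hinj : Function.Injective ι := by
    -- `𝔤 ∘ ι` is induced by a full inclusion of graphs, hence is injective.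
    have := Function.LeftInverse.injective (RAAG.retract_map (fixedGraph.incl 𝔤)
      (fun _ _ hab => hab) Subtype.val_injective)
    rw [← h𝔤ι] at this
    exact Function.Injective.of_comp this
  have hsurj : Function.Surjective ι := fun g => by
    -- The pair is `C𝔤` and the unit of `CG`, both split by `Cε`; the fixed graph is their equalizer
    -- by definition.
    obtain ⟨y, hy⟩ := RAAG.exists_map_eq_of_map_eq (fixedGraph.incl 𝔤) (fun _ _ hab => hab)
      Subtype.val_injective (commGraph.map 𝔤) (RAAG.unit (commGraph G))
      (commGraph.map (AC.counit G)) hε (fun a => AC.counit_of a)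
      (fun a ha => ⟨⟨a, ha⟩, rfl⟩) (fun c => c.2)
      (x := 𝔤 g) (DFunLike.congr_fun h.coassoc g)
    rw [← h𝔤ι] at hy
    exact ⟨y, h𝔤inj hy⟩
  let e : RAAG (fixedGraph 𝔤) ≃* G := MulEquiv.ofBijective ι ⟨hinj, hsurj⟩
  refine ⟨e.symm, IsACCohom.symm (e := e) (RAAG.hom_ext fun a => ?_)⟩
  have he : e.toMonoidHom = ι := rfl
  rw [he, MonoidHom.comp_apply, MonoidHom.comp_apply, RAAG.canonical_of, AC.map_of, hι, a.2]

/-- The conjuncts say, in order: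
* a group is isomorphic to a RAAG if and only if it admits an `AC`-coalgebra structure;
* the canonical map `AΓ → AC(AΓ)` is such a structure;
* a homomorphism `AΓ → AΔ` is `Aφ` for a graph homomorphism `φ` if and only if it respects the
  canonical structure maps;
* for arbitrary coalgebra structures: each `(G, 𝔤)` is identified with some `AΓ` and its canonical
  structure, and under any such identifications of `(G, 𝔤)` with `AΓ` and of `(H, 𝔥)` with `AΔ`,
  a homomorphism `G → H` is `Aφ` for some `φ` if and only if it respects `𝔤` and `𝔥`. -/
theorem mainTheorem2 :
    (∀ (G : Type u) [Group G], IsRAAG G ↔ ∃ 𝔤 : G →* AC G, IsACCoalgebra 𝔤) ∧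
    (∀ (V : Type u) (Γ : ReflGraph V), IsACCoalgebra (RAAG.canonical Γ)) ∧
    (∀ (V : Type u) (W : Type v) (Γ : ReflGraph V) (Δ : ReflGraph W) (f : RAAG Γ →* RAAG Δ),
      (∃ φ : Γ.Hom Δ, f = RAAG.map φ) ↔
        IsACCohom (RAAG.canonical Γ) (RAAG.canonical Δ) f) ∧
    (∀ (G : Type u) [Group G] (𝔤 : G →* AC G), IsACCoalgebra 𝔤 →
      ∃ (V : Type u) (Γ : ReflGraph V) (e : G ≃* RAAG Γ),
        IsACCohom 𝔤 (RAAG.canonical Γ) e.toMonoidHom) ∧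
    (∀ (G : Type u) (H : Type v) [Group G] [Group H] (𝔤 : G →* AC G) (𝔥 : H →* AC H),
      IsACCoalgebra 𝔤 → IsACCoalgebra 𝔥 →
      ∀ (V : Type w) (W : Type x) (Γ : ReflGraph V) (Δ : ReflGraph W)
        (e : G ≃* RAAG Γ) (e' : H ≃* RAAG Δ),
        IsACCohom 𝔤 (RAAG.canonical Γ) e.toMonoidHom →
        IsACCohom 𝔥 (RAAG.canonical Δ) e'.toMonoidHom →
        ∀ f : G →* H,
          (∃ φ : Γ.Hom Δ, e'.toMonoidHom.comp f = (RAAG.map φ).comp e.toMonoidHom) ↔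
            IsACCohom 𝔤 𝔥 f) := by
  refine ⟨fun G _ => ⟨?_, ?_⟩, fun V Γ => .of_canonical Γ,
    fun V W Γ Δ f => RAAG.exists_eq_map_iff f, fun G _ 𝔤 h => ⟨_, _, h.exists_equiv⟩, ?_⟩
  · rintro ⟨V, Γ, ⟨e⟩⟩
    exact ⟨_, (IsACCoalgebra.of_canonical Γ).transport e⟩
  · rintro ⟨𝔤, h⟩
    obtain ⟨e, -⟩ := h.exists_equiv
    exact ⟨_, _, ⟨e⟩⟩
  · intro G H _ _ 𝔤 𝔥 _ _ V W Γ Δ e e' he he' f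
    have h1 : e.symm.toMonoidHom.comp e.toMonoidHom = MonoidHom.id G := by ext; simp
    have h2 : e'.symm.toMonoidHom.comp e'.toMonoidHom = MonoidHom.id H := by ext; simp
    constructor
    · rintro ⟨φ, hφ⟩
      have hc := he'.symm.comp (((RAAG.exists_eq_map_iff _).mp ⟨φ, rfl⟩).comp he)
      rwa [← hφ, ← MonoidHom.comp_assoc, h2, MonoidHom.id_comp] at hc
    · intro hf
      obtain ⟨φ, hφ⟩ := (RAAG.exists_eq_map_iff _).mpr (he'.comp (hf.comp he.symm))
      refine ⟨φ, ?_⟩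
      rw [← hφ, MonoidHom.comp_assoc, MonoidHom.comp_assoc, h1, MonoidHom.comp_id]
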